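/- Let $S^3\subset\mathbb R^4=\mathbb C^2$ be the round unit sphere, oriented as the boundary of the unit ball, and identify it with $SU(2)$ by $(z_1,z_2)\mapsto\begin{pmatrix} z_1&-\bar z_2\\ z_2&\bar z_1\end{pmatrix}$. For a smooth (real) tangent vector field $V$ on $S^3$ let $\operatorname{curl}V=(\star\, dV^\flat)^\sharp$. Let $V\not\equiv 0$ be a smooth tangent vector field on $S^3$ with $\operatorname{curl}V=\mu V$ for some real constant $\mu$, and suppose that the pointwise norm $|V|$ is constant on $S^3$. (a) If $\mu>0$, then $\mu=2$ (the fundamental positive eigenvalue) and $V$ is a linear combination, with constant real coefficients, of the three left-invariant (Hopf, or Reeb) fields $q\mapsto q\,\tau_a$, where $\tau_1,\tau_2,\tau_3$ is a basis of $\mathfrak{su}(2)$. (b) If $\mu<0$, then $\mu=-2$ and $V$ is a linear combination, with constant real coefficients, of the three right-invariant fields $q\mapsto \tau_a\,q$. -/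

import Mathlib

open scoped Manifold ContDiff

noncomputable section

namespace CurlSphere

/-- Euclidean space `ℝ⁴`. -/
abbrev E4 : Type := EuclideanSpace ℝ (Fin 4)

/-- The unit sphere `S³ ⊂ ℝ⁴`, with Mathlib's smooth manifold structure. -/
abbrev S3 : Type := Metric.sphere (0 : E4) 1

instance finrankE4 : Fact (Module.finrank ℝ E4 = 3 + 1) := ⟨by simp⟩

/-- The standard basis vector `e_b` of `ℝ⁴`. -/
def stdVec (b : Fin 4) : E4 := EuclideanSpace.single b 1

/-- The radial projection `x ↦ x / ‖x‖` of `ℝ⁴ ∖ {0}` onto `S³` (the value at `0` is irrelevant). -/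
def radialProj (x : E4) : S3 :=
  open Classical in
  if h : x = 0 then ⟨stdVec 0, by simp [stdVec]⟩
  else ⟨‖x‖⁻¹ • x, by simp [norm_smul, h]⟩

/-- For `u` tangent to `S³` at `p`, `sphereDeriv V p u` is the derivative at `p` of `V : S³ → ℝ⁴`
in the direction `u`; it vanishes for `u` normal to the sphere. It is computed by extending `V`
to `ℝ⁴ ∖ {0}` as constant along rays. -/
def sphereDeriv (V : S3 → E4) (p : S3) : E4 →L[ℝ] E4 :=
  fderiv ℝ (fun x => V (radialProj x)) (p : E4)

/-- The determinant of four vectors in `ℝ⁴`. For `p ∈ S³`, the form `(u, v, w) ↦ det4 p u v w`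
on `p^⊥` is the Riemannian volume form of the round unit sphere, oriented as the boundary of
the unit ball (outward normal first, standard orientation of `ℝ⁴`). -/
def det4 (p u v w : E4) : ℝ :=
  Matrix.det (Matrix.of fun i j : Fin 4 => (![p, u, v, w] i) j)

/-- The curl `(⋆ d V^♭)^♯` of a tangent vector field `V` on the round oriented unit sphere `S³`,
that is `curl V = ∑_b e_b × ∇_{e_b} V` with `⟪u × v, w⟫ = det4 p u v w`. The sum may run over the
standard basis of `ℝ⁴` (the normal part of `e_b` drops out, as does the normal part of the
derivative), and the result is tangent to the sphere. -/
def curl (V : S3 → E4) (p : S3) : E4 :=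
  WithLp.toLp 2 fun d : Fin 4 =>
    ∑ b : Fin 4, det4 (p : E4) (stdVec b) (sphereDeriv V p (stdVec b)) (stdVec d)

/-- `V` is a smooth tangent vector field on `S³`. -/
structure IsSmoothField (V : S3 → E4) : Prop where
  smooth : ContMDiff (𝓡 3) 𝓘(ℝ, E4) ∞ V
  tangent : ∀ p : S3, inner ℝ (p : E4) (V p) = 0

/-- `V` is a (nonzero, smooth, real) eigenfield of the curl operator, with eigenvalue `μ`. -/
structure IsCurlEigenfield (V : S3 → E4) (μ : ℝ) : Prop where
  isSmoothField : IsSmoothField V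
  ne_zero : V ≠ 0
  curl_eq : ∀ p : S3, curl V p = μ • V p

/-- The identification of `ℝ⁴ = ℂ²` with the real multiples of `SU(2)`,
`(z₁, z₂) ↦ [[z₁, -z̄₂], [z₂, z̄₁]]` where `z₁ = x₀ + i x₁` and `z₂ = x₂ + i x₃`.
It maps `S³` onto `SU(2)`. -/
def toMat (x : E4) : Matrix (Fin 2) (Fin 2) ℂ :=
  !![⟨x 0, x 1⟩, ⟨-x 2, x 3⟩; ⟨x 2, x 3⟩, ⟨x 0, -x 1⟩]

/-- A basis of the Lie algebra `su(2)`. -/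
def tau : Fin 3 → Matrix (Fin 2) (Fin 2) ℂ :=
  ![!![Complex.I, 0; 0, -Complex.I], !![0, -1; 1, 0], !![0, Complex.I; Complex.I, 0]]

/-- The three left-invariant fields `q ↦ q τ_a` on `S³ = SU(2)` (the Hopf, or Reeb, fields). -/
def leftField (a : Fin 3) (p : S3) : E4 :=
  let x : E4 := p
  ![!₂[-x 1, x 0, -x 3, x 2], !₂[-x 2, x 3, x 0, -x 1], !₂[-x 3, -x 2, x 1, x 0]] a

/-- The three right-invariant fields `q ↦ τ_a q` on `S³ = SU(2)` (the anti-Hopf fields). -/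
def rightField (a : Fin 3) (p : S3) : E4 :=
  let x : E4 := p
  ![!₂[-x 1, x 0, x 3, -x 2], !₂[-x 2, -x 3, x 0, x 1], !₂[-x 3, x 2, -x 1, x 0]] a

theorem toMat_leftField (a : Fin 3) (p : S3) :
    toMat (leftField a p) = toMat p * tau a := by
  fin_cases a <;> ext i j <;> fin_cases i <;> fin_cases j <;>
    simp [toMat, leftField, tau, Matrix.mul_apply, Complex.ext_iff]

theorem toMat_rightField (a : Fin 3) (p : S3) :
    toMat (rightField a p) = tau a * toMat p := by
  fin_cases a <;> ext i j <;> fin_cases i <;> fin_cases j <;>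
    simp [toMat, rightField, tau, Matrix.mul_apply, Complex.ext_iff]

end CurlSphere

end

open scoped Manifold ContDiff

namespace CurlSphere

/-- Three derivations `D a` of a real algebra with `[D a, D (a+1)] = κ D (a+2)`, and a triple `f`
of unit length that is an eigenvector, with eigenvalue `ν`, of the curl built from the `D a`. -/
structure IsUnitBeltrami {R : Type*} [CommRing R] [Algebra ℝ R] (D : Fin 3 → Derivation ℝ R R)
    (f : Fin 3 → R) (κ ν : ℝ) : Prop where
  comm : ∀ a g, D a (D (a + 1) g) - D (a + 1) (D a g) = algebraMap ℝ R κ * D (a + 2) g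
  unit : ∑ a, f a ^ 2 = 1
  curl : ∀ a, D a (f (a + 1)) - D (a + 1) (f a) = algebraMap ℝ R ν * f (a + 2)

/-! ### Algebra of unit Beltrami triples: divergence, Laplacian, Bochner identities. -/

namespace IsUnitBeltrami

variable {R : Type*} [CommRing R] [Algebra ℝ R] {D : Fin 3 → Derivation ℝ R R}
  {f : Fin 3 → R} {κ ν : ℝ}

theorem eq_zero_of_algebraMap_mul {c : ℝ} (hc : c ≠ 0) {x : R} (h : algebraMap ℝ R c * x = 0) :
    x = 0 := by
  have h1 : algebraMap ℝ R c⁻¹ * algebraMap ℝ R c = 1 := by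
    rw [← map_mul, inv_mul_cancel₀ hc, map_one]
  linear_combination algebraMap ℝ R c⁻¹ * h - x * h1

theorem eq_zero_of_two_mul {x : R} (h : 2 * x = 0) : x = 0 :=
  eq_zero_of_algebraMap_mul (c := 2) two_ne_zero
    (by rwa [map_ofNat])

theorem comm_zero (h : IsUnitBeltrami D f κ ν) (g : R) :
    D 0 (D 1 g) - D 1 (D 0 g) = algebraMap ℝ R κ * D 2 g := h.comm 0 g

theorem comm_one (h : IsUnitBeltrami D f κ ν) (g : R) :
    D 1 (D 2 g) - D 2 (D 1 g) = algebraMap ℝ R κ * D 0 g := h.comm 1 g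

theorem comm_two (h : IsUnitBeltrami D f κ ν) (g : R) :
    D 2 (D 0 g) - D 0 (D 2 g) = algebraMap ℝ R κ * D 1 g := h.comm 2 g

theorem curl_zero (h : IsUnitBeltrami D f κ ν) :
    D 0 (f 1) - D 1 (f 0) = algebraMap ℝ R ν * f 2 := h.curl 0

theorem curl_one (h : IsUnitBeltrami D f κ ν) :
    D 1 (f 2) - D 2 (f 1) = algebraMap ℝ R ν * f 0 := h.curl 1

theorem curl_two (h : IsUnitBeltrami D f κ ν) :
    D 2 (f 0) - D 0 (f 2) = algebraMap ℝ R ν * f 1 := h.curl 2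

theorem unit_sq (h : IsUnitBeltrami D f κ ν) : f 0 ^ 2 + f 1 ^ 2 + f 2 ^ 2 = 1 := by
  simpa [Fin.sum_univ_three] using h.unit

theorem map_algebraMap_mul (δ : Derivation ℝ R R) (c : ℝ) (x : R) :
    δ (algebraMap ℝ R c * x) = algebraMap ℝ R c * δ x := by
  simp

/-- The divergence of `f` vanishes. -/
theorem div_eq_zero (h : IsUnitBeltrami D f κ ν) (hν : ν ≠ κ) :
    D 0 (f 0) + D 1 (f 1) + D 2 (f 2) = 0 := by
  have h0 := congrArg (D 2) h.curl_zero
  have h1 := congrArg (D 0) h.curl_one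
  have h2 := congrArg (D 1) h.curl_two
  rw [map_sub, map_algebraMap_mul] at h0 h1 h2
  apply eq_zero_of_algebraMap_mul (sub_ne_zero.2 hν)
  rw [map_sub]
  -- The divergence of the curl is not zero in a noncommuting frame: the commutators turn it into
  -- `κ` times the divergence, while the equation makes it `ν` times the divergence.
  linear_combination -h0 - h1 - h2 + h.comm_zero (f 2) + h.comm_one (f 0) + h.comm_two (f 1)

/-- The derivative of a unit triple is orthogonal to it. -/
theorem inner_deriv_eq_zero (h : IsUnitBeltrami D f κ ν) (a : Fin 3) :
    f 0 * D a (f 0) + f 1 * D a (f 1) + f 2 * D a (f 2) = 0 := by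
  have h0 := congrArg (D a) h.unit_sq
  apply eq_zero_of_two_mul
  simp only [map_add, Derivation.leibniz_pow, Derivation.map_one_eq_zero, nsmul_eq_mul,
    smul_eq_mul, pow_one, Nat.add_one_sub_one] at h0
  push_cast at h0
  linear_combination h0

/-- The triple `f` is constant in its own direction. -/
theorem deriv_self_eq_zero (h : IsUnitBeltrami D f κ ν) (b : Fin 3) :
    f 0 * D 0 (f b) + f 1 * D 1 (f b) + f 2 * D 2 (f b) = 0 := by
  -- This is `(f·∇)f = ∇(|f|²/2) - f × curl f`; the last term vanishes because the curl is parallel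
  -- to `f`.
  have := h.inner_deriv_eq_zero b
  fin_cases b
  · simp only [Fin.zero_eta, Fin.isValue] at *
    linear_combination this + f 2 * h.curl_two - f 1 * h.curl_zero
  · simp only [Fin.mk_one, Fin.isValue] at *
    linear_combination this + f 0 * h.curl_zero - f 2 * h.curl_one
  · simp only [Fin.reduceFinMk, Fin.isValue] at *
    linear_combination this + f 1 * h.curl_one - f 0 * h.curl_two

/-- Each `f b` is an eigenfunction of the Laplacian. -/
theorem laplacian (h : IsUnitBeltrami D f κ ν) (hν : ν ≠ κ) (b : Fin 3) :
    D 0 (D 0 (f b)) + D 1 (D 1 (f b)) + D 2 (D 2 (f b))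
      = -algebraMap ℝ R (ν * (ν - κ)) * f b := by
  have hc0 := fun a => congrArg (D a) h.curl_zero
  have hc1 := fun a => congrArg (D a) h.curl_one
  have hc2 := fun a => congrArg (D a) h.curl_two
  have hd := congrArg (D b) (h.div_eq_zero hν)
  simp only [map_sub, map_algebraMap_mul, map_add, map_zero] at hc0 hc1 hc2 hd
  rw [map_mul, map_sub]
  -- The identity `curl curl = grad div - Δ`, with commutator corrections that shift one factor `ν`
  -- to `ν - κ`.
  fin_cases b
  · simp only [Fin.zero_eta, Fin.isValue] at *
    linear_combination hd + hc2 2 - hc0 1 + h.comm_two (f 2) - h.comm_zero (f 1)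
      + (algebraMap ℝ R κ - algebraMap ℝ R ν) * h.curl_one
  · simp only [Fin.mk_one, Fin.isValue] at *
    linear_combination hd + hc0 0 - hc1 2 + h.comm_zero (f 0) - h.comm_one (f 2)
      + (algebraMap ℝ R κ - algebraMap ℝ R ν) * h.curl_two
  · simp only [Fin.reduceFinMk, Fin.isValue] at *
    linear_combination hd + hc1 1 - hc2 0 + h.comm_one (f 1) - h.comm_two (f 0)
      + (algebraMap ℝ R κ - algebraMap ℝ R ν) * h.curl_zero

/-- The Laplacian commutes with each `D b`. -/
theorem laplacian_comm (h : IsUnitBeltrami D f κ ν) (b : Fin 3) (g : R) :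
    D 0 (D 0 (D b g)) + D 1 (D 1 (D b g)) + D 2 (D 2 (D b g))
      = D b (D 0 (D 0 g) + D 1 (D 1 g) + D 2 (D 2 g)) := by
  have h0 := fun a => congrArg (D a) (h.comm_zero g)
  have h1 := fun a => congrArg (D a) (h.comm_one g)
  have h2 := fun a => congrArg (D a) (h.comm_two g)
  simp only [map_sub, map_algebraMap_mul, map_add] at h0 h1 h2 ⊢
  fin_cases b
  · simp only [Fin.zero_eta, Fin.isValue] at *
    linear_combination h2 2 - h0 1 + h.comm_two (D 2 g) - h.comm_zero (D 1 g)
  · simp only [Fin.mk_one, Fin.isValue] at *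
    linear_combination h0 0 - h1 2 + h.comm_zero (D 0 g) - h.comm_one (D 2 g)
  · simp only [Fin.reduceFinMk, Fin.isValue] at *
    linear_combination h1 1 - h2 0 + h.comm_one (D 1 g) - h.comm_two (D 0 g)

theorem deriv_deriv_sq (g : R) (a : Fin 3) :
    D a (D a (g ^ 2)) = 2 * (D a g ^ 2 + g * D a (D a g)) := by
  simp only [Derivation.leibniz_pow, Derivation.leibniz, nsmul_eq_mul,
    smul_eq_mul, pow_one, Nat.add_one_sub_one, Derivation.map_natCast]
  ring

/-- If eigenfunctions `g i` of the Laplacian have constant sum of squares, then so do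
their derivatives. -/
theorem sum_deriv_sq {ι : Type*} [Fintype ι] {g : ι → R} {l c : ℝ}
    (hl : ∀ i, D 0 (D 0 (g i)) + D 1 (D 1 (g i)) + D 2 (D 2 (g i)) = -algebraMap ℝ R l * g i)
    (hc : ∑ i, g i ^ 2 = algebraMap ℝ R c) :
    ∑ i, (D 0 (g i) ^ 2 + D 1 (g i) ^ 2 + D 2 (g i) ^ 2) = algebraMap ℝ R (l * c) := by
  have h0 := fun a => congrArg (fun x => D a (D a x)) hc
  simp only [map_sum, deriv_deriv_sq, Derivation.map_algebraMap, map_zero] at h0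
  refine sub_eq_zero.1 (eq_zero_of_two_mul ?_)
  -- Expand `Δ(g²) = 2|Dg|² + 2gΔg` and sum; the left side of the expansion is `Δ` of a constant.
  have key : ∑ i, 2 * (D 0 (g i) ^ 2 + D 1 (g i) ^ 2 + D 2 (g i) ^ 2)
      = ∑ i, 2 * (D 0 (g i) ^ 2 + g i * D 0 (D 0 (g i)))
        + ∑ i, 2 * (D 1 (g i) ^ 2 + g i * D 1 (D 1 (g i)))
        + ∑ i, 2 * (D 2 (g i) ^ 2 + g i * D 2 (D 2 (g i)))
        + 2 * (algebraMap ℝ R l * ∑ i, g i ^ 2) := by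
    rw [Finset.mul_sum, Finset.mul_sum, ← Finset.sum_add_distrib, ← Finset.sum_add_distrib,
      ← Finset.sum_add_distrib]
    refine Finset.sum_congr rfl fun i _ => ?_
    linear_combination -2 * g i * hl i
  rw [h0, h0, h0, hc, ← Finset.mul_sum] at key
  rw [map_mul]
  linear_combination key

theorem sum_deriv_sq_eq (h : IsUnitBeltrami D f κ ν) (hν : ν ≠ κ) :
    ∑ b, (D 0 (f b) ^ 2 + D 1 (f b) ^ 2 + D 2 (f b) ^ 2) = algebraMap ℝ R (ν * (ν - κ)) := by
  simpa using sum_deriv_sq (l := ν * (ν - κ)) (c := 1) (h.laplacian hν) (by simpa using h.unit)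

/-- The nine functions `D a (f b)` are again eigenfunctions with constant sum of squares, so the
Bochner identity can be used a second time. -/
theorem sum_deriv_deriv_sq_eq (h : IsUnitBeltrami D f κ ν) (hν : ν ≠ κ) :
    ∑ i : Fin 3 × Fin 3, (D 0 (D i.1 (f i.2)) ^ 2 + D 1 (D i.1 (f i.2)) ^ 2
      + D 2 (D i.1 (f i.2)) ^ 2) = algebraMap ℝ R ((ν * (ν - κ)) ^ 2) := by
  rw [sq (ν * (ν - κ))]
  refine sum_deriv_sq (g := fun i : Fin 3 × Fin 3 => D i.1 (f i.2)) (fun i => ?_) ?_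
  · rw [h.laplacian_comm, h.laplacian hν, neg_mul, map_neg, map_algebraMap_mul, neg_mul]
  · rw [← h.sum_deriv_sq_eq hν, Fintype.sum_prod_type, Finset.sum_comm]
    simp only [Fin.sum_univ_three]

/-! ### Determination of the eigenvalue at one point. -/

/-- The pointwise linear algebra behind the determination of the eigenvalue: `M` and `N` are the
first and second derivatives of a unit triple at a point where it equals the last basis vector. -/
theorem eigenvalue_of_matrices {M : Fin 3 → Fin 3 → ℝ} {N : Fin 3 → Fin 3 → Fin 3 → ℝ} {κ ν : ℝ}
    (hκ : κ ≠ 0) (hcurl : M 0 1 - M 1 0 = ν)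
    (hdiv : M 0 0 + M 1 1 = 0)
    (hM : M 0 0 ^ 2 + M 1 0 ^ 2 + (M 0 1 ^ 2 + M 1 1 ^ 2) = ν * (ν - κ))
    (hN₁ : ∀ a b, N a b 2 = -(M b 0 * M a 0 + M b 1 * M a 1))
    (hN₂ : ∀ a c, N a 2 c = -(M a 0 * M 0 c + M a 1 * M 1 c))
    (hc₁ : ∀ c, N 1 2 c - N 2 1 c = κ * M 0 c) (hc₂ : ∀ c, N 2 0 c - N 0 2 c = κ * M 1 c)
    (hN : ∑ a, ∑ b, ∑ c, N a b c ^ 2 = (ν * (ν - κ)) ^ 2) :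
    ν = 0 ∨ ν = 2 * κ := by
  have hd : M 1 1 = -M 0 0 := by linarith
  have n200 : N 2 0 0 = -(M 0 0 ^ 2 + M 0 1 * M 1 0) + κ * M 1 0 := by
    linear_combination hc₂ 0 + hN₂ 0 0
  have n201 : N 2 0 1 = -κ * M 0 0 := by
    linear_combination hc₂ 1 + hN₂ 0 1 + (κ - M 0 1) * hd
  have n210 : N 2 1 0 = -κ * M 0 0 := by
    linear_combination -hc₁ 0 + hN₂ 1 0 - M 1 0 * hd
  have n211 : N 2 1 1 = -(M 0 0 ^ 2 + M 0 1 * M 1 0) - κ * M 0 1 := by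
    linear_combination -hc₁ 1 + hN₂ 1 1 + (M 0 0 - M 1 1) * hd
  have n002 := hN₁ 0 0
  have n012 := hN₁ 0 1
  have n102 := hN₁ 1 0
  have n112 := hN₁ 1 1
  have n020 := hN₂ 0 0
  have n021 := hN₂ 0 1
  have n120 := hN₂ 1 0
  have n121 := hN₂ 1 1
  have key : N 2 0 0 ^ 2 + N 2 0 1 ^ 2 + N 2 1 0 ^ 2 + N 2 1 1 ^ 2 ≤ 0 := by
    simp only [Fin.sum_univ_three] at hN
    -- For trace-free `M` one has `M² = -det M · I`, whence `|M Mᵀ|² + |M²|² = |M|⁴`. These eight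
    -- entries exhaust the total.
    have hsum : N 0 0 2 ^ 2 + N 0 1 2 ^ 2 + N 1 0 2 ^ 2 + N 1 1 2 ^ 2 + N 0 2 0 ^ 2 + N 0 2 1 ^ 2
        + N 1 2 0 ^ 2 + N 1 2 1 ^ 2 = (ν * (ν - κ)) ^ 2 := by
      rw [n002, n012, n102, n112, n020, n021, n120, n121, ← hM, hd]
      ring
    have p := fun a b c => sq_nonneg (N a b c)
    linarith only [hN, hsum, p 0 0 0, p 0 0 1, p 0 1 0, p 0 1 1, p 1 0 0, p 1 0 1, p 1 1 0, p 1 1 1, p 0 2 2,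
      p 1 2 2, p 2 0 2, p 2 1 2, p 2 2 0, p 2 2 1, p 2 2 2]
  have z200 : N 2 0 0 = 0 := by
    rw [← sq_eq_zero_iff]
    linarith only [key, sq_nonneg (N 2 0 0), sq_nonneg (N 2 0 1), sq_nonneg (N 2 1 0),
      sq_nonneg (N 2 1 1)]
  have z201 : N 2 0 1 = 0 := by
    rw [← sq_eq_zero_iff]
    linarith only [key, sq_nonneg (N 2 0 0), sq_nonneg (N 2 0 1), sq_nonneg (N 2 1 0),
      sq_nonneg (N 2 1 1)]
  have z211 : N 2 1 1 = 0 := by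
    rw [← sq_eq_zero_iff]
    linarith only [key, sq_nonneg (N 2 0 0), sq_nonneg (N 2 0 1), sq_nonneg (N 2 1 0),
      sq_nonneg (N 2 1 1)]
  -- The vanishing of the entries `N 2 b c` makes `M` antisymmetric, so `M 0 1 = ν / 2`, and leaves
  -- one quadratic equation for `ν`.
  have ha : M 0 0 = 0 := by
    rw [n201] at z201
    simpa [hκ] using z201
  rw [n200, ha] at z200
  rw [n211, ha] at z211
  have hb : M 1 0 = -M 0 1 := by
    apply mul_left_cancel₀ hκ
    linear_combination z200 - z211
  rw [hb] at z200 hcurl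
  have : ν * (ν - 2 * κ) = 0 := by
    rw [← hcurl]
    linear_combination 4 * z200
  rcases mul_eq_zero.1 this with h | h
  · exact Or.inl h
  · exact Or.inr (by linarith)

/-- The eigenvalue is one of two values, provided `f` points in the last direction
at some point. -/
theorem eigenvalue_of_adapted (h : IsUnitBeltrami D f κ ν) (hν : ν ≠ κ) (hκ : κ ≠ 0)
    (ev : R →ₐ[ℝ] ℝ) (e0 : ev (f 0) = 0) (e1 : ev (f 1) = 0) (e2 : ev (f 2) = 1) :
    ν = 0 ∨ ν = 2 * κ := by
  have hin := fun a => congrArg ev (h.inner_deriv_eq_zero a)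
  have hself := fun a => congrArg ev (h.deriv_self_eq_zero a)
  have hin2 := fun a b => congrArg (fun x => ev (D b x)) (h.inner_deriv_eq_zero a)
  have hself2 := fun a b => congrArg (fun x => ev (D b x)) (h.deriv_self_eq_zero a)
  have hcurl := congrArg ev h.curl_zero
  have hdiv := congrArg ev (h.div_eq_zero hν)
  have hM := congrArg ev (h.sum_deriv_sq_eq hν)
  have hN := congrArg ev (h.sum_deriv_deriv_sq_eq hν)
  have hc1 := fun b => congrArg ev (h.comm_one (f b))
  have hc2 := fun b => congrArg ev (h.comm_two (f b))
  simp only [Fintype.sum_prod_type, Fin.sum_univ_three, map_add, map_sub,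
    map_mul, map_pow, Derivation.leibniz, smul_eq_mul, map_zero,
    e0, e1, e2, AlgHom.commutes, zero_mul, one_mul, zero_add, mul_one,
    Algebra.algebraMap_self, RingHom.id_apply, add_zero]
    at hin hself hin2 hself2 hcurl hdiv hM hN hc1 hc2
  refine eigenvalue_of_matrices (M := fun a b => ev (D a (f b)))
    (N := fun a b c => ev (D a (D b (f c)))) hκ hcurl ?_ ?_ ?_ ?_ hc1 hc2 ?_
  · linear_combination hdiv - hin 2
  · simpa [hself, hin] using hM
  · intro a b
    linear_combination hin2 b a - ev (D b (f 2)) * hin a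
  · intro a c
    linear_combination hself2 c a - ev (D 2 (f c)) * hin a
  · simp only [Fin.sum_univ_three]
    linear_combination hN

end IsUnitBeltrami

/-! ### Rotation to an adapted frame. -/

/-- Every unit vector of `ℝ³` is the last row of a rotation matrix. -/
theorem exists_rotation {v : Fin 3 → ℝ} (hv : ∑ a, v a ^ 2 = 1) :
    ∃ u : Fin 3 → Fin 3 → ℝ, u 2 = v ∧ (∀ a b, ∑ i, u i a * u i b = if a = b then 1 else 0) ∧
      ∀ i a, u i a * u (i + 1) (a + 1) - u i (a + 1) * u (i + 1) a = u (i + 2) (a + 2) := by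
  simp only [Fin.sum_univ_three] at hv
  have hv2 : v = ![v 0, v 1, v 2] := by
    ext i; fin_cases i <;> rfl
  by_cases h0 : v 0 ^ 2 + v 1 ^ 2 = 0
  · have a0 : v 0 = 0 := by nlinarith [sq_nonneg (v 0), sq_nonneg (v 1)]
    have a1 : v 1 = 0 := by nlinarith [sq_nonneg (v 0), sq_nonneg (v 1)]
    have a2 : v 2 ^ 2 = 1 := by linarith
    refine ⟨![![1, 0, 0], ![0, v 2, 0], v], rfl, ?_, ?_⟩
    · intro a b
      fin_cases a <;> fin_cases b <;> simp [Fin.sum_univ_three, a0, a1] <;> linarith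
    · intro i a
      fin_cases i <;> fin_cases a <;> (simp [a0, a1]; try linarith)
  · set ρ := √(v 0 ^ 2 + v 1 ^ 2) with hρ
    have hsq : ρ ^ 2 = v 0 ^ 2 + v 1 ^ 2 := Real.sq_sqrt (by positivity)
    have hρ0 : ρ ≠ 0 := fun h => h0 (by rw [← hsq, h]; ring)
    have e1 : v 0 ^ 2 = ρ ^ 2 - v 1 ^ 2 := by linarith
    have e2 : v 2 ^ 2 = 1 - ρ ^ 2 := by linarith
    -- The first row is the horizontal unit vector orthogonal to `v`; the second is its cross
    -- product `v × u 0`.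
    refine ⟨![![-v 1 / ρ, v 0 / ρ, 0], ![-v 2 * v 0 / ρ, -v 2 * v 1 / ρ, ρ], v], rfl, ?_, ?_⟩
    · intro a b
      fin_cases a <;> fin_cases b <;> simp [Fin.sum_univ_three] <;> field_simp <;>
        ring_nf <;> simp only [e1, e2] <;> ring
    · intro i a
      fin_cases i <;> fin_cases a <;> simp <;> field_simp <;>
        ring_nf <;> simp only [e1, e2] <;> ring

namespace IsUnitBeltrami

variable {R : Type*} [CommRing R] [Algebra ℝ R] {D : Fin 3 → Derivation ℝ R R}
  {f : Fin 3 → R} {κ ν : ℝ}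

/-- Unit Beltrami triples are preserved by constant rotations of the frame. -/
theorem rotate (h : IsUnitBeltrami D f κ ν) {u : Fin 3 → Fin 3 → ℝ}
    (horth : ∀ a b, ∑ i, u i a * u i b = if a = b then 1 else 0)
    (hcross : ∀ i a, u i a * u (i + 1) (a + 1) - u i (a + 1) * u (i + 1) a
      = u (i + 2) (a + 2)) :
    IsUnitBeltrami (fun i => ∑ a, u i a • D a) (fun i => ∑ a, algebraMap ℝ R (u i a) * f a)
      κ ν := by
  have hc : ∀ i a, algebraMap ℝ R (u i a) * algebraMap ℝ R (u (i + 1) (a + 1))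
      - algebraMap ℝ R (u i (a + 1)) * algebraMap ℝ R (u (i + 1) a)
      = algebraMap ℝ R (u (i + 2) (a + 2)) := fun i a => by
    rw [← hcross i a]; simp only [map_sub, map_mul]
  have hc0 : ∀ i, algebraMap ℝ R (u i 0) * algebraMap ℝ R (u (i + 1) 1)
      - algebraMap ℝ R (u i 1) * algebraMap ℝ R (u (i + 1) 0)
      = algebraMap ℝ R (u (i + 2) 2) := fun i => hc i 0
  have hc1 : ∀ i, algebraMap ℝ R (u i 1) * algebraMap ℝ R (u (i + 1) 2)
      - algebraMap ℝ R (u i 2) * algebraMap ℝ R (u (i + 1) 1)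
      = algebraMap ℝ R (u (i + 2) 0) := fun i => hc i 1
  have hc2 : ∀ i, algebraMap ℝ R (u i 2) * algebraMap ℝ R (u (i + 1) 0)
      - algebraMap ℝ R (u i 0) * algebraMap ℝ R (u (i + 1) 2)
      = algebraMap ℝ R (u (i + 2) 1) := fun i => hc i 2
  refine ⟨fun i g => ?_, ?_, fun i => ?_⟩
  · simp only [Derivation.coe_add, Derivation.coe_smul, Pi.add_apply, Pi.smul_apply,
      Fin.sum_univ_three, map_add]
    simp only [Algebra.smul_def, map_algebraMap_mul]
    rw [← hc0, ← hc1, ← hc2]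
    linear_combination
      (algebraMap ℝ R (u i 0) * algebraMap ℝ R (u (i + 1) 1)
        - algebraMap ℝ R (u i 1) * algebraMap ℝ R (u (i + 1) 0)) * h.comm_zero g
      + (algebraMap ℝ R (u i 1) * algebraMap ℝ R (u (i + 1) 2)
        - algebraMap ℝ R (u i 2) * algebraMap ℝ R (u (i + 1) 1)) * h.comm_one g
      + (algebraMap ℝ R (u i 2) * algebraMap ℝ R (u (i + 1) 0)
        - algebraMap ℝ R (u i 0) * algebraMap ℝ R (u (i + 1) 2)) * h.comm_two g
  · have ho := fun a b => congrArg (algebraMap ℝ R) (horth a b)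
    simp only [Fin.sum_univ_three, map_add, map_mul] at ho ⊢
    have h00 := ho 0 0
    have h11 := ho 1 1
    have h22 := ho 2 2
    have h01 := ho 0 1
    have h02 := ho 0 2
    have h12 := ho 1 2
    simp at h00 h11 h22 h01 h02 h12
    linear_combination h.unit_sq + f 0 ^ 2 * h00 + f 1 ^ 2 * h11 + f 2 ^ 2 * h22
      + 2 * f 0 * f 1 * h01 + 2 * f 0 * f 2 * h02 + 2 * f 1 * f 2 * h12
  · simp only [Derivation.coe_add, Derivation.coe_smul, Pi.add_apply, Pi.smul_apply,
      Fin.sum_univ_three, map_add]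
    simp only [Algebra.smul_def, map_algebraMap_mul]
    rw [← hc0, ← hc1, ← hc2]
    linear_combination
      (algebraMap ℝ R (u i 0) * algebraMap ℝ R (u (i + 1) 1)
        - algebraMap ℝ R (u i 1) * algebraMap ℝ R (u (i + 1) 0)) * h.curl_zero
      + (algebraMap ℝ R (u i 1) * algebraMap ℝ R (u (i + 1) 2)
        - algebraMap ℝ R (u i 2) * algebraMap ℝ R (u (i + 1) 1)) * h.curl_one
      + (algebraMap ℝ R (u i 2) * algebraMap ℝ R (u (i + 1) 0)
        - algebraMap ℝ R (u i 0) * algebraMap ℝ R (u (i + 1) 2)) * h.curl_two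

/-- The eigenvalue of a unit Beltrami triple is one of two values. -/
theorem eigenvalue (h : IsUnitBeltrami D f κ ν) (hν : ν ≠ κ) (hκ : κ ≠ 0) (ev : R →ₐ[ℝ] ℝ) :
    ν = 0 ∨ ν = 2 * κ := by
  have hv : ∑ a, ev (f a) ^ 2 = 1 := by
    simpa only [map_sum, map_pow, map_one] using congrArg ev h.unit
  obtain ⟨u, hu, horth, hcross⟩ := exists_rotation hv
  have e : ∀ i, ev (∑ a, algebraMap ℝ R (u i a) * f a) = ∑ a, u i a * u 2 a := fun i => by
    simp [hu]
  have h0 : u 0 0 * u 1 1 - u 0 1 * u 1 0 = u 2 2 := hcross 0 0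
  have h1 : u 0 1 * u 1 2 - u 0 2 * u 1 1 = u 2 0 := hcross 0 1
  have h2 : u 0 2 * u 1 0 - u 0 0 * u 1 2 = u 2 1 := hcross 0 2
  refine (h.rotate horth hcross).eigenvalue_of_adapted hν hκ ev ?_ ?_ ?_
  · rw [e]
    simp only [Fin.sum_univ_three]
    rw [← h0, ← h1, ← h2]
    ring
  · rw [e]
    simp only [Fin.sum_univ_three]
    rw [← h0, ← h1, ← h2]
    ring
  · rw [e, ← hv, hu]
    exact Finset.sum_congr rfl fun a _ => (sq _).symm

end IsUnitBeltrami

/-! ### Calculus on the sphere through extensions constant along rays. -/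

theorem coe_radialProj {x : E4} (hx : x ≠ 0) : (radialProj x : E4) = ‖x‖⁻¹ • x := by
  simp [radialProj, hx]

theorem coe_ne_zero (p : S3) : (p : E4) ≠ 0 := ne_zero_of_mem_unit_sphere p

theorem norm_coe (p : S3) : ‖(p : E4)‖ = 1 := norm_eq_of_mem_sphere p

@[simp]
theorem radialProj_coe (p : S3) : radialProj p = p := by
  ext1
  rw [coe_radialProj (coe_ne_zero p), norm_coe, inv_one, one_smul]

theorem radialProj_smul {c : ℝ} (hc : 0 < c) {x : E4} (hx : x ≠ 0) :
    radialProj (c • x) = radialProj x := by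
  ext1
  rw [coe_radialProj hx, coe_radialProj (smul_ne_zero hc.ne' hx), norm_smul, smul_smul,
    Real.norm_of_nonneg hc.le]
  congr 1
  field_simp

theorem contDiffOn_normalize :
    ContDiffOn ℝ ∞ (fun x : E4 => ‖x‖⁻¹ • x) {0}ᶜ := fun _ hx =>
  ((contDiffAt_norm ℝ hx).inv (norm_ne_zero_iff.2 hx)).smul contDiffAt_id |>.contDiffWithinAt

theorem contDiffOn_coe_radialProj :
    ContDiffOn ℝ ∞ (fun x : E4 => (radialProj x : E4)) {0}ᶜ :=
  contDiffOn_normalize.congr fun _ hx => coe_radialProj hx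

/-- A smooth map on `S³`, extended as constant along rays, is smooth away from the origin. -/
theorem contDiffOn_comp_radialProj {V : S3 → E4} (hV : ContMDiff (𝓡 3) 𝓘(ℝ, E4) ∞ V) :
    ContDiffOn ℝ ∞ (fun x => V (radialProj x)) {0}ᶜ := by
  let U : TopologicalSpace.Opens E4 := ⟨{0}ᶜ, isOpen_compl_singleton⟩
  have hU : ContMDiff 𝓘(ℝ, E4) 𝓘(ℝ, E4) ∞ fun x : U => (radialProj (x : E4) : E4) := fun x =>
    (contMDiffAt_subtype_iff (f := fun y : E4 => (radialProj y : E4))).2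
      (contDiffOn_coe_radialProj.contDiffAt (isOpen_compl_singleton.mem_nhds x.2)).contMDiffAt
  have hπ : ContMDiff 𝓘(ℝ, E4) (𝓡 3) ∞ fun x : U => radialProj (x : E4) :=
    hU.codRestrict_sphere fun x => (radialProj (x : E4)).2
  intro x hx
  have := (contMDiffAt_subtype_iff (f := fun y : E4 => V (radialProj y)) (x := (⟨x, hx⟩ : U))).1
    ((hV.comp hπ) ⟨x, hx⟩)
  exact this.contDiffAt.contDiffWithinAt

/-- The algebra of real functions on `S³` that are smooth when extended as constant along rays. -/
noncomputable def smoothFunctions : Subalgebra ℝ (S3 → ℝ) where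
  carrier := {g | ContDiffOn ℝ ∞ (fun x => g (radialProj x)) {0}ᶜ}
  mul_mem' ha hb := ContDiffOn.mul ha hb
  add_mem' ha hb := ContDiffOn.add ha hb
  algebraMap_mem' _ := contDiffOn_const

theorem contDiffAt_of_mem (g : smoothFunctions) {x : E4} (hx : x ≠ 0) :
    ContDiffAt ℝ ∞ (fun y => g.1 (radialProj y)) x :=
  g.2.contDiffAt (isOpen_compl_singleton.mem_nhds hx)

theorem differentiableAt_of_mem (g : smoothFunctions) {x : E4} (hx : x ≠ 0) :
    DifferentiableAt ℝ (fun y => g.1 (radialProj y)) x :=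
  (contDiffAt_of_mem g hx).differentiableAt (by simp)

/-- The derivative along a linear vector field does not change under scaling. -/
theorem fderiv_radialProj (g : S3 → ℝ) (J : E4 →L[ℝ] E4) {x : E4} (hx : x ≠ 0) :
    fderiv ℝ (fun y => g (radialProj y)) (radialProj x) (J (radialProj x))
      = fderiv ℝ (fun y => g (radialProj y)) x (J x) := by
  have hc : 0 < ‖x‖⁻¹ := inv_pos.2 (norm_pos_iff.2 hx)
  have h1 : (fun y => g (radialProj (‖x‖⁻¹ • y))) =ᶠ[nhds x] fun y => g (radialProj y) := by
    filter_upwards [isOpen_compl_singleton.mem_nhds hx] with y hy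
    rw [radialProj_smul hc hy]
  have h2 := fderiv_comp_smul (𝕜 := ℝ) (f := fun y => g (radialProj y)) (x := x) ‖x‖⁻¹
  rw [h1.fderiv_eq] at h2
  rw [h2, coe_radialProj hx, map_smul, map_smul, smul_apply]

/-- The derivation of the algebra of smooth functions given by a linear vector field. -/
noncomputable def linearDerivation (J : E4 →L[ℝ] E4) : Derivation ℝ smoothFunctions smoothFunctions :=
  Derivation.mk'
    { toFun := fun g => ⟨fun p => fderiv ℝ (fun y => g.1 (radialProj y)) p (J p), by
        have h1 : ContDiffOn ℝ ∞ (fun x => fderiv ℝ (fun y => g.1 (radialProj y)) x (J x)) {0}ᶜ :=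
          fun x hx => (((contDiffAt_of_mem g hx).fderiv_right (m := ∞) (by simp)).clm_apply
            J.contDiff.contDiffAt).contDiffWithinAt
        -- A linear field has degree one, so it maps extensions of degree zero to extensions of
        -- degree zero.
        exact h1.congr fun x hx => fderiv_radialProj g.1 J hx⟩
      map_add' := fun g h => Subtype.ext <| funext fun p => by
        have := fderiv_fun_add (differentiableAt_of_mem g (coe_ne_zero p))
          (differentiableAt_of_mem h (coe_ne_zero p))
        simpa using congrArg (fun L : E4 →L[ℝ] ℝ => L (J p)) this
      map_smul' := fun c g => Subtype.ext <| funext fun p => by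
        have := fderiv_fun_const_smul (differentiableAt_of_mem g (coe_ne_zero p)) c
        simpa using congrArg (fun L : E4 →L[ℝ] ℝ => L (J p)) this }
    fun g h => Subtype.ext <| funext fun p => by
      have := fderiv_fun_mul (differentiableAt_of_mem g (coe_ne_zero p))
        (differentiableAt_of_mem h (coe_ne_zero p))
      simpa using congrArg (fun L : E4 →L[ℝ] ℝ => L (J p)) this

theorem linearDerivation_apply (J : E4 →L[ℝ] E4) (g : smoothFunctions) (p : S3) :
    (linearDerivation J g).1 p = fderiv ℝ (fun y => g.1 (radialProj y)) p (J p) := rfl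

theorem linearDerivation_apply_radialProj (J : E4 →L[ℝ] E4) (g : smoothFunctions) {x : E4}
    (hx : x ≠ 0) : (linearDerivation J g).1 (radialProj x)
      = fderiv ℝ (fun y => g.1 (radialProj y)) x (J x) := fderiv_radialProj g.1 J hx

theorem linearDerivation_comp (J K : E4 →L[ℝ] E4) (g : smoothFunctions) (p : S3) :
    (linearDerivation J (linearDerivation K g)).1 p
      = fderiv ℝ (fderiv ℝ fun y => g.1 (radialProj y)) p (J p) (K p)
        + fderiv ℝ (fun y => g.1 (radialProj y)) p (K (J p)) := by
  have h1 : (fun y => (linearDerivation K g).1 (radialProj y)) =ᶠ[nhds (p : E4)]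
      fun x => fderiv ℝ (fun y => g.1 (radialProj y)) x (K x) := by
    filter_upwards [isOpen_compl_singleton.mem_nhds (coe_ne_zero p)] with y hy
    exact linearDerivation_apply_radialProj K g hy
  have h2 : DifferentiableAt ℝ (fderiv ℝ fun y => g.1 (radialProj y)) (p : E4) :=
    ((contDiffAt_of_mem g (coe_ne_zero p)).fderiv_right (m := ∞) (by simp)).differentiableAt
      (by simp)
  rw [linearDerivation_apply, h1.fderiv_eq, fderiv_clm_apply h2 K.differentiableAt]
  simp [add_comm]

/-- Linear vector fields commute as their matrices do. -/
theorem linearDerivation_commutator (J K : E4 →L[ℝ] E4) (g : smoothFunctions) (p : S3) :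
    (linearDerivation J (linearDerivation K g)).1 p
        - (linearDerivation K (linearDerivation J g)).1 p
      = fderiv ℝ (fun y => g.1 (radialProj y)) p (K (J p) - J (K p)) := by
  -- Symmetry of the second derivative cancels the second-order terms.
  have hsymm := (contDiffAt_of_mem g (coe_ne_zero p)).isSymmSndFDerivAt
    (by simpa using WithTop.coe_le_coe.2 (le_top : (2 : ℕ∞) ≤ ⊤))
  rw [linearDerivation_comp, linearDerivation_comp, hsymm.eq (J p) (K p), map_sub]
  ring

/-! ### The left- and right-invariant frames. -/

/-- Three linear vector fields on `ℝ⁴` that restrict to a positively oriented orthonormal frame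
of `S³`, closed under commutators with structure constant `κ`. -/
structure IsLinearFrame (J : Fin 3 → E4 →L[ℝ] E4) (κ : ℝ) : Prop where
  commutator : ∀ a x, J (a + 1) (J a x) - J a (J (a + 1) x) = κ • J (a + 2) x
  tangent : ∀ a x, inner ℝ x (J a x) = 0
  norm_sq_smul : ∀ x v, ‖x‖ ^ 2 • v = inner ℝ x v • x + ∑ a, inner ℝ v (J a x) • J a x
  det_eq : ∀ (A : E4 →L[ℝ] E4) p a,
    ∑ d, J (a + 2) p d * ∑ b, det4 p (stdVec b) (A (stdVec b)) (stdVec d)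
      = inner ℝ (A (J a p)) (J (a + 1) p) - inner ℝ (A (J (a + 1) p)) (J a p)

/-- The linear vector fields `x ↦ x τ_a` on `ℝ⁴`. -/
noncomputable def leftFrame (a : Fin 3) : E4 →L[ℝ] E4 :=
  LinearMap.toContinuousLinearMap
    { toFun := fun x =>
        ![!₂[-x 1, x 0, -x 3, x 2], !₂[-x 2, x 3, x 0, -x 1], !₂[-x 3, -x 2, x 1, x 0]] a
      map_add' := fun x y => by
        fin_cases a <;> ext i <;> fin_cases i <;> simp <;> ring
      map_smul' := fun c x => by
        fin_cases a <;> ext i <;> fin_cases i <;> simp }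

/-- The linear vector fields `x ↦ τ_a x` on `ℝ⁴`. -/
noncomputable def rightFrame (a : Fin 3) : E4 →L[ℝ] E4 :=
  LinearMap.toContinuousLinearMap
    { toFun := fun x =>
        ![!₂[-x 1, x 0, x 3, -x 2], !₂[-x 2, -x 3, x 0, x 1], !₂[-x 3, x 2, -x 1, x 0]] a
      map_add' := fun x y => by
        fin_cases a <;> ext i <;> fin_cases i <;> simp <;> ring
      map_smul' := fun c x => by
        fin_cases a <;> ext i <;> fin_cases i <;> simp }

theorem leftFrame_apply (a : Fin 3) (x : E4) : leftFrame a x =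
    ![!₂[-x 1, x 0, -x 3, x 2], !₂[-x 2, x 3, x 0, -x 1], !₂[-x 3, -x 2, x 1, x 0]] a := rfl

theorem rightFrame_apply (a : Fin 3) (x : E4) : rightFrame a x =
    ![!₂[-x 1, x 0, x 3, -x 2], !₂[-x 2, -x 3, x 0, x 1], !₂[-x 3, x 2, -x 1, x 0]] a := rfl

theorem inner_eq (x y : E4) :
    inner ℝ x y = x 0 * y 0 + x 1 * y 1 + x 2 * y 2 + x 3 * y 3 := by
  simp [PiLp.inner_apply, Fin.sum_univ_four, mul_comm]

theorem clm_apply_eq (A : E4 →L[ℝ] E4) (x : E4) (i : Fin 4) :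
    A x i = x 0 * A (stdVec 0) i + x 1 * A (stdVec 1) i + x 2 * A (stdVec 2) i
      + x 3 * A (stdVec 3) i := by
  have : x = x 0 • stdVec 0 + x 1 • stdVec 1 + x 2 • stdVec 2 + x 3 • stdVec 3 := by
    ext j; fin_cases j <;> simp [stdVec]
  conv_lhs => rw [this]
  simp

theorem det4_stdVec_left (p w z : E4) (b : Fin 4) : det4 p (stdVec b) w z =
  ![-(p 1 * (w 2 * z 3 - w 3 * z 2) - p 2 * (w 1 * z 3 - w 3 * z 1) + p 3 * (w 1 * z 2 - w 2 * z 1)),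
    p 0 * (w 2 * z 3 - w 3 * z 2) - p 2 * (w 0 * z 3 - w 3 * z 0) + p 3 * (w 0 * z 2 - w 2 * z 0),
    -(p 0 * (w 1 * z 3 - w 3 * z 1) - p 1 * (w 0 * z 3 - w 3 * z 0) + p 3 * (w 0 * z 1 - w 1 * z 0)),
    p 0 * (w 1 * z 2 - w 2 * z 1) - p 1 * (w 0 * z 2 - w 2 * z 0) + p 2 * (w 0 * z 1 - w 1 * z 0)]
    b := by
  rw [det4, Matrix.det_succ_row_zero]
  simp only [Fin.sum_univ_four, Matrix.det_fin_three]
  fin_cases b <;> simp [stdVec, Fin.succAbove] <;> ring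

theorem isLinearFrame_leftFrame : IsLinearFrame leftFrame (-2) where
  commutator a x := by
    fin_cases a <;> ext i <;> fin_cases i <;> simp [leftFrame_apply] <;> ring
  tangent a x := by
    rw [inner_eq]
    fin_cases a <;> simp [leftFrame_apply] <;> ring
  norm_sq_smul x v := by
    rw [← real_inner_self_eq_norm_sq]
    simp only [inner_eq, Fin.sum_univ_three]
    ext i; fin_cases i <;> simp [leftFrame_apply] <;> ring
  det_eq A p a := by
    simp only [inner_eq, clm_apply_eq A (leftFrame _ _), det4_stdVec_left, Fin.sum_univ_four]
    fin_cases a <;> simp [leftFrame_apply, stdVec] <;> ring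

theorem isLinearFrame_rightFrame : IsLinearFrame rightFrame 2 where
  commutator a x := by
    fin_cases a <;> ext i <;> fin_cases i <;> simp [rightFrame_apply] <;> ring
  tangent a x := by
    rw [inner_eq]
    fin_cases a <;> simp [rightFrame_apply] <;> ring
  norm_sq_smul x v := by
    rw [← real_inner_self_eq_norm_sq]
    simp only [inner_eq, Fin.sum_univ_three]
    ext i; fin_cases i <;> simp [rightFrame_apply] <;> ring
  det_eq A p a := by
    simp only [inner_eq, clm_apply_eq A (rightFrame _ _), det4_stdVec_left, Fin.sum_univ_four]
    fin_cases a <;> simp [rightFrame_apply, stdVec] <;> ring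

/-! ### Components of a vector field in a frame. -/

/-- The derivative of the radial projection fixes tangent vectors. -/
theorem fderiv_coe_radialProj (p : S3) {u : E4} (hu : inner ℝ (p : E4) u = 0) :
    fderiv ℝ (fun y => (radialProj y : E4)) p u = u := by
  have hp := coe_ne_zero p
  have hπ : DifferentiableAt ℝ (fun y => (radialProj y : E4)) (p : E4) :=
    (contDiffOn_coe_radialProj.contDiffAt (isOpen_compl_singleton.mem_nhds hp)).differentiableAt
      (by simp)
  have hn : DifferentiableAt ℝ (fun y : E4 => ‖y‖) (p : E4) :=
    (contDiffAt_norm ℝ (n := 1) hp).differentiableAt (by simp)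
  have hn0 : fderiv ℝ (fun y : E4 => ‖y‖) (p : E4) u = 0 := by
    have h1 := congrArg (fun L : E4 →L[ℝ] ℝ => L u) (fderiv_fun_pow 2 hn)
    simpa [fderiv_norm_sq_apply, hu, norm_coe] using h1.symm
  -- Differentiate `y = ‖y‖ • radialProj y`: in a tangent direction the norm is stationary.
  have hid : (fun y : E4 => ‖y‖ • (radialProj y : E4)) =ᶠ[nhds (p : E4)] id := by
    filter_upwards [isOpen_compl_singleton.mem_nhds hp] with y hy
    rw [coe_radialProj hy, smul_smul, mul_inv_cancel₀ (norm_ne_zero_iff.2 hy), one_smul, id]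
  have h2 := congrArg (fun L : E4 →L[ℝ] E4 => L u)
    (hid.fderiv_eq.symm.trans (fderiv_fun_smul hn hπ))
  simpa [hn0, norm_coe] using h2.symm

/-- The component of a smooth vector field along a linear vector field. -/
noncomputable def component {V : S3 → E4} (hV : IsSmoothField V) (J : E4 →L[ℝ] E4) : smoothFunctions :=
  ⟨fun p => inner ℝ (V p) (J p), (contDiffOn_comp_radialProj hV.smooth).inner ℝ
    (J.contDiff.comp_contDiffOn contDiffOn_coe_radialProj)⟩

theorem component_apply {V : S3 → E4} (hV : IsSmoothField V) (J : E4 →L[ℝ] E4) (p : S3) :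
    (component hV J).1 p = inner ℝ (V p) (J p) := rfl

/-- Product rule; tangency of `J` is needed because the derivative of the radial projection is the
identity only on tangent vectors. -/
theorem linearDerivation_component {V : S3 → E4} (hV : IsSmoothField V) {J : E4 →L[ℝ] E4}
    (hJ : ∀ x, inner ℝ x (J x) = 0) (K : E4 →L[ℝ] E4) (p : S3) :
    (linearDerivation J (component hV K)).1 p
      = inner ℝ (sphereDeriv V p (J p)) (K p) + inner ℝ (V p) (K (J p)) := by
  have hmem := isOpen_compl_singleton.mem_nhds (coe_ne_zero p)
  have h1 : DifferentiableAt ℝ (fun y => V (radialProj y)) (p : E4) :=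
    ((contDiffOn_comp_radialProj hV.smooth).contDiffAt hmem).differentiableAt (by simp)
  have h2 : DifferentiableAt ℝ (fun y => (radialProj y : E4)) (p : E4) :=
    (contDiffOn_coe_radialProj.contDiffAt hmem).differentiableAt (by simp)
  have h3 : fderiv ℝ (fun y => K (radialProj y : E4)) (p : E4) (J p) = K (J p) := by
    have h4 : HasFDerivAt (fun y => K (radialProj y : E4)) _ (p : E4) :=
      K.hasFDerivAt.comp (p : E4) h2.hasFDerivAt
    rw [h4.fderiv, ContinuousLinearMap.comp_apply, fderiv_coe_radialProj p (hJ p)]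
  have h5 : DifferentiableAt ℝ (fun y => K (radialProj y : E4)) (p : E4) :=
    K.differentiableAt.comp _ h2
  rw [linearDerivation_apply]
  simp only [component_apply]
  rw [fderiv_inner_apply ℝ h1 h5, h3, radialProj_coe, sphereDeriv,
    add_comm]

theorem inner_curl (V : S3 → E4) (p : S3) (u : E4) : inner ℝ (curl V p) u
    = ∑ d, u d * ∑ b, det4 p (stdVec b) (sphereDeriv V p (stdVec b)) (stdVec d) := by
  simp [curl, PiLp.inner_apply]

theorem fderiv_radial_eq_zero (g : smoothFunctions) {x : E4} (hx : x ≠ 0) :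
    fderiv ℝ (fun y => g.1 (radialProj y)) x x = 0 := by
  have h1 : HasDerivAt (fun t : ℝ => t • x) x 1 := by
    simpa using (hasDerivAt_id (1 : ℝ)).smul_const x
  have h2 : HasFDerivAt (fun y => g.1 (radialProj y))
      (fderiv ℝ (fun y => g.1 (radialProj y)) x) ((1 : ℝ) • x) := by
    rw [one_smul]
    exact (differentiableAt_of_mem g hx).hasFDerivAt
  have h3 := h2.comp_hasDerivAt 1 h1
  have h4 : (fun y => g.1 (radialProj y)) ∘ (fun t : ℝ => t • x) =ᶠ[nhds 1]
      fun _ => g.1 (radialProj x) := by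
    filter_upwards [lt_mem_nhds (zero_lt_one' ℝ)] with t ht
    rw [Function.comp_apply, radialProj_smul ht hx]
  exact h3.unique ((hasDerivAt_const 1 _).congr_of_eventuallyEq h4)

/-! ### From curl eigenfields to Beltrami triples and back. -/

namespace IsLinearFrame

variable {J : Fin 3 → E4 →L[ℝ] E4} {κ : ℝ}

/-- A function annihilated by the derivations of a frame is constant. -/
theorem exists_eq_const (hJ : IsLinearFrame J κ) (g : smoothFunctions)
    (hg : ∀ a, linearDerivation (J a) g = 0) : ∃ c, ∀ p, g.1 p = c := by
  have hder : ∀ x : E4, x ≠ 0 → fderiv ℝ (fun y => g.1 (radialProj y)) x = 0 := by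
    intro x hx
    have h1 : ∀ a, fderiv ℝ (fun y => g.1 (radialProj y)) x (J a x) = 0 := fun a => by
      rw [← linearDerivation_apply_radialProj (J a) g hx, hg a]
      rfl
    ext v
    have h2 := congrArg (fderiv ℝ (fun y => g.1 (radialProj y)) x) (hJ.norm_sq_smul x v)
    simp only [map_smul, map_add, map_sum, h1, fderiv_radial_eq_zero g hx, smul_zero,
      Finset.sum_const_zero, add_zero, smul_eq_zero] at h2
    exact h2.resolve_left (pow_ne_zero 2 (norm_ne_zero_iff.2 hx))
  have hconn : IsPreconnected ({0}ᶜ : Set E4) :=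
    (isConnected_compl_singleton_of_one_lt_rank 
      (by rw [← Module.finrank_eq_rank, finrank_euclideanSpace_fin]; norm_num) 0).isPreconnected
  obtain ⟨c, hc⟩ := isOpen_compl_singleton.exists_is_const_of_fderiv_eq_zero hconn
    (fun x hx => (differentiableAt_of_mem g hx).differentiableWithinAt) hder
  refine ⟨c, fun p => ?_⟩
  simpa using hc (p : E4) (coe_ne_zero p)

theorem eq_sum_component (hJ : IsLinearFrame J κ) {V : S3 → E4} (hV : IsSmoothField V) (p : S3) :
    V p = ∑ a, (component hV (J a)).1 p • J a p := by
  simpa [norm_coe, hV.tangent p, component_apply] using hJ.norm_sq_smul p (V p)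

theorem sum_component_sq (hJ : IsLinearFrame J κ) {V : S3 → E4} (hV : IsSmoothField V) (p : S3) :
    ∑ a, (component hV (J a)).1 p ^ 2 = ‖V p‖ ^ 2 := by
  rw [← real_inner_self_eq_norm_sq]
  have h := congrArg (inner ℝ (V p)) (hJ.eq_sum_component hV p)
  rw [h, inner_sum]
  refine Finset.sum_congr rfl fun a _ => ?_
  rw [inner_smul_right, component_apply, sq]

/-- The frame components of a curl eigenfield. -/
theorem curl_component (hJ : IsLinearFrame J κ) {V : S3 → E4} (hV : IsSmoothField V) {μ : ℝ}
    (hμ : ∀ p, curl V p = μ • V p) (a : Fin 3) :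
    linearDerivation (J a) (component hV (J (a + 1)))
        - linearDerivation (J (a + 1)) (component hV (J a))
      = algebraMap ℝ smoothFunctions (μ + κ) * component hV (J (a + 2)) := by
  refine Subtype.ext (funext fun p => ?_)
  have h1 := inner_curl V p (J (a + 2) p)
  rw [hμ p, inner_smul_left, hJ.det_eq] at h1
  -- The derivative of the frame itself contributes the commutator, which raises the eigenvalue from
  -- `μ` to `μ + κ`.
  have h2 := congrArg (inner ℝ (V p)) (hJ.commutator a (p : E4))
  rw [inner_sub_right, inner_smul_right] at h2
  change (linearDerivation (J a) (component hV (J (a + 1)))).1 p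
    - (linearDerivation (J (a + 1)) (component hV (J a))).1 p
    = (μ + κ) * (component hV (J (a + 2))).1 p
  rw [linearDerivation_component hV (hJ.tangent a), component_apply,
    linearDerivation_component hV (hJ.tangent (a + 1))]
  simp only [conj_trivial] at h1
  linear_combination h2 - h1

theorem isUnitBeltrami (hJ : IsLinearFrame J κ) {V : S3 → E4} (hV : IsSmoothField V) {μ r : ℝ}
    (hμ : ∀ p, curl V p = μ • V p) (hr : r ≠ 0) (hnorm : ∀ p, ‖V p‖ = r) :
    IsUnitBeltrami (fun a => linearDerivation (J a))
      (fun a => algebraMap ℝ smoothFunctions r⁻¹ * component hV (J a)) κ (μ + κ) where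
  comm a g := by
    refine Subtype.ext (funext fun p => ?_)
    change (linearDerivation (J a) (linearDerivation (J (a + 1)) g)).1 p
      - (linearDerivation (J (a + 1)) (linearDerivation (J a) g)).1 p
      = κ * (linearDerivation (J (a + 2)) g).1 p
    rw [linearDerivation_commutator, hJ.commutator, map_smul, linearDerivation_apply, smul_eq_mul]
  unit := by
    refine Subtype.ext (funext fun p => ?_)
    have h1 : ∑ a, (r⁻¹ * (component hV (J a)).1 p) ^ 2 = 1 := by
      simp only [mul_pow]
      rw [← Finset.mul_sum, hJ.sum_component_sq hV p, hnorm p, inv_pow,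
        inv_mul_cancel₀ (pow_ne_zero 2 hr)]
    simp only [Fin.sum_univ_three] at h1 ⊢
    exact h1
  curl a := by
    simp only [IsUnitBeltrami.map_algebraMap_mul]
    linear_combination algebraMap ℝ smoothFunctions r⁻¹ * hJ.curl_component hV hμ a

/-- Evaluation of smooth functions at a point. -/
noncomputable def evalAt (p : S3) : smoothFunctions →ₐ[ℝ] ℝ :=
  (Pi.evalAlgHom ℝ (fun _ : S3 => ℝ) p).comp smoothFunctions.val

/-- A curl eigenfield of constant norm has eigenvalue `κ` or `-κ`; in the second case its
components in the frame are constant. -/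
theorem eigenvalue (hJ : IsLinearFrame J κ) (hκ : κ ≠ 0) {V : S3 → E4} {μ : ℝ} (hμ0 : μ ≠ 0)
    (hV : IsCurlEigenfield V μ) {r : ℝ} (hnorm : ∀ p, ‖V p‖ = r) :
    μ = κ ∨ μ = -κ ∧ ∃ c : Fin 3 → ℝ, ∀ p : S3, V p = ∑ a, c a • J a p := by
  have hr : r ≠ 0 := by
    rintro rfl
    exact hV.ne_zero (funext fun p => norm_eq_zero.1 (hnorm p))
  have hne : μ + κ ≠ κ := by simpa using hμ0
  have hB := hJ.isUnitBeltrami hV.isSmoothField hV.curl_eq hr hnorm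
  -- Any point of the sphere serves; `radialProj 0` merely names one.
  rcases hB.eigenvalue hne hκ (evalAt (radialProj 0)) with h | h
  · refine Or.inr ⟨by linarith, ?_⟩
    have hM := hB.sum_deriv_sq_eq hne
    rw [h, zero_mul, map_zero] at hM
    have hzero : ∀ a b, linearDerivation (J a) (component hV.isSmoothField (J b)) = 0 := by
      intro a b
      refine Subtype.ext (funext fun p => ?_)
      have h1 := congrArg (evalAt p) hM
      simp only [IsUnitBeltrami.map_algebraMap_mul, map_sum, map_add, map_pow, map_mul,
        map_zero, AlgHom.commutes, Algebra.algebraMap_self, RingHom.id_apply] at h1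
      rw [Finset.sum_eq_zero_iff_of_nonneg (fun _ _ => by positivity)] at h1
      have h2 : ∑ i, (r⁻¹ * evalAt p (linearDerivation (J i)
          (component hV.isSmoothField (J b)))) ^ 2 = 0 := by
        rw [Fin.sum_univ_three]
        exact h1 b (Finset.mem_univ b)
      have h3 := (Finset.sum_eq_zero_iff_of_nonneg fun _ _ => sq_nonneg _).1 h2 a
        (Finset.mem_univ a)
      have h4 : evalAt p (linearDerivation (J a) (component hV.isSmoothField (J b))) = 0 := by
        simpa [hr] using h3
      exact h4
    choose c hc using fun b => hJ.exists_eq_const (component hV.isSmoothField (J b))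
      fun a => hzero a b
    refine ⟨c, fun p => ?_⟩
    rw [hJ.eq_sum_component hV.isSmoothField p]
    simp only [hc]
  · exact Or.inl (by linarith)

end IsLinearFrame
end CurlSphere

theorem mainTheorem2 (V : CurlSphere.S3 → CurlSphere.E4) (μ : ℝ)
    (hV : CurlSphere.IsCurlEigenfield V μ)
    (hnorm : ∃ r : ℝ, ∀ p, ‖V p‖ = r) :
    (0 < μ → μ = 2 ∧ ∃ c : Fin 3 → ℝ, ∀ p, V p = ∑ a, c a • CurlSphere.leftField a p) ∧
    (μ < 0 → μ = -2 ∧ ∃ c : Fin 3 → ℝ, ∀ p, V p = ∑ a, c a • CurlSphere.rightField a p) := by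
  obtain ⟨r, hr⟩ := hnorm
  refine ⟨fun hμ => ?_, fun hμ => ?_⟩
  -- Here `κ = -2`, so `μ > 0` excludes `μ = κ`; the negative case uses `κ = 2` in the same way.
  · rcases CurlSphere.isLinearFrame_leftFrame.eigenvalue (by norm_num) hμ.ne' hV hr with h | h
    · linarith
    · exact ⟨by linarith [h.1], h.2⟩
  · rcases CurlSphere.isLinearFrame_rightFrame.eigenvalue two_ne_zero hμ.ne hV hr with h | h
    · linarith
    · exact h
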